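/- Let $d\ge 1$. For $N\ge 1$ let $T^d_N$ be the torus graph with vertex set $(\mathbb Z/N\mathbb Z)^d$, in which two distinct vertices are adjacent if and only if they agree in all coordinates but one and differ by $\pm1$ modulo $N$ in the remaining one. Let $G$ be a graph without loops, with base vertex $x_0$, and let $D_G$ be its symmetric digraph, having the two arcs $(u,v)$ and $(v,u)$ for every edge $uv$. An alternating walk of length $k\ge 1$ in $D_G$ is a sequence of vertices $v_0,\dots,v_k$ with arcs $e_1,\dots,e_k$ of alternating direction: either $e_1=(v_0,v_1),\ e_2=(v_2,v_1),\ e_3=(v_2,v_3),\dots$ (starting with an out-edge) or $e_1=(v_1,v_0),\ e_2=(v_1,v_2),\ e_3=(v_3,v_2),\dots$ (starting with an in-edge). It is an $x_0$-alternating cycle if $v_0=v_k=x_0$ and $e_1,e_k$ both have origin $x_0$ or both have terminus $x_0$; it is reduced if $e_{i+1}\ne e_i$ for $1\le i<k$ and $e_k\neq e_1$. Let $N^0_k(G)$ be the number of reduced $x_0$-alternating cycles of length $k$, of both kinds, and let \[ \zeta_a(G,t)=\exp\Bigl(\sum_{k\ge1}\frac{N^0_k(G)}{k}t^k\Bigr)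 \] be the generalized alternating zeta function of $G$. For a nonzero Laurent polynomial $f$ in $X_1,\dots,X_d$ let \[ m(f)=\int_{[0,1)^d}\log\bigl|f(e^{2\pi i s_1},\dots,e^{2\pi i s_d})\bigr|\,ds_1\cdots ds_d \] be its logarithmic Mahler measure. Theorem. Let $-\frac1{2d-1}<t<0$ and $c=(2d-1)t+t^{-1}$, and choose any base vertices in the graphs $T^d_N$. Then the series defining $\zeta_a(T^d_N,t)$ converges for every $N\ge1$, the limit $\lim_{N\to\infty}\zeta_a(T^d_N,t)^{-1}$ exists and is positive, the integrals defining the two Mahler measures below converge absolutely, and $\mathcal L(T^d_\infty,t):=\log\bigl[\lim_{N\to\infty}\zeta_a(T^d_N,t)^{-1}\bigr]$ satisfies \[ \mathcal L(T^d_\infty,t)=2(d-1)\log(1-t^2)+2\log(-t)+m\Bigl(\sum_{j=1}^d(X_j+X_j^{-1})-c\Bigr)+m\Bigl(-\sum_{j=1}^d(X_j+X_j^{-1})-c\Bigr). \] -/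

import Mathlib

open Filter Topology MeasureTheory

noncomputable section

namespace AltZeta

/-! ### Alternating walks and the generalized alternating zeta function -/

/-- The symmetric digraph of a graph: both arcs `(u, v)` and `(v, u)` for every edge `uv`. -/
def symDigraph {V : Type*} (G : SimpleGraph V) : Digraph V where
  Adj u v := G.Adj u v

/-- The `i`-th arc (counted from `0`) of the alternating walk with vertices `v 0, …, v r`.
If the walk starts with an out-edge (`out = true`), the arcs are
`(v 0, v 1), (v 2, v 1), (v 2, v 3), …`; if it starts with an in-edge (`out = false`), they are
`(v 1, v 0), (v 1, v 2), (v 3, v 2), …`. -/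
def altArc {V : Type*} {r : ℕ} (out : Bool) (v : Fin (r + 1) → V) (i : Fin r) : V × V :=
  if Even (i : ℕ) ↔ out = true then (v i.castSucc, v i.succ) else (v i.succ, v i.castSucc)

/-- An alternating walk of length `r` in a digraph. -/
structure AltWalk {V : Type*} (D : Digraph V) (r : ℕ) where
  /-- does the walk start with an out-edge? -/
  out : Bool
  /-- the vertices of the walk -/
  vert : Fin (r + 1) → V
  /-- consecutive vertices are joined by arcs of alternating direction -/
  adj : ∀ i : Fin r, D.Adj (altArc out vert i).1 (altArc out vert i).2

namespace AltWalk

variable {V : Type*} {D : Digraph V}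

/-- The arcs `e_1, …, e_r` (indexed from `0`) of an alternating walk. -/
def arc {r : ℕ} (P : AltWalk D r) (i : Fin r) : V × V := altArc P.out P.vert i

/-- `P` is an `x`-alternating cycle: it starts and ends at `x`, and the first and the last arc
both have origin `x` or both have terminus `x`. -/
def IsCycleAt {n : ℕ} (P : AltWalk D (n + 1)) (x : V) : Prop :=
  P.vert 0 = x ∧ P.vert (Fin.last (n + 1)) = x ∧
    (((P.arc 0).1 = x ∧ (P.arc (Fin.last n)).1 = x) ∨
      ((P.arc 0).2 = x ∧ (P.arc (Fin.last n)).2 = x))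

/-- Some two consecutive arcs coincide. -/
def HasBacktracking {n : ℕ} (P : AltWalk D (n + 1)) : Prop :=
  ∃ i : Fin n, P.arc i.succ = P.arc i.castSucc

/-- The last arc is the first one. -/
def HasTail {n : ℕ} (P : AltWalk D (n + 1)) : Prop :=
  P.arc (Fin.last n) = P.arc 0

/-- Neither a backtracking nor a tail. -/
def IsReduced {n : ℕ} (P : AltWalk D (n + 1)) : Prop :=
  ¬ P.HasBacktracking ∧ ¬ P.HasTail

end AltWalk

/-- The number of reduced `x`-alternating cycles of length `n + 1` in (the symmetric digraph of)
the graph `G`. -/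
def numReducedCycles {V : Type*} (G : SimpleGraph V) (x : V) (n : ℕ) : ℕ :=
  Nat.card {P : AltWalk (symDigraph G) (n + 1) // P.IsCycleAt x ∧ P.IsReduced}

/-- The term of index `k = n + 1` of the series `∑_{k ≥ 1} (N_k / k) t ^ k`. -/
def zetaTerm {V : Type*} (G : SimpleGraph V) (x : V) (t : ℝ) (n : ℕ) : ℝ :=
  (numReducedCycles G x n : ℝ) / ((n + 1 : ℕ) : ℝ) * t ^ (n + 1)

/-- The generalized alternating zeta function `exp (∑_{k ≥ 1} (N_k / k) t ^ k)` of the graph `G`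
with base vertex `x`. -/
def altZeta {V : Type*} (G : SimpleGraph V) (x : V) (t : ℝ) : ℝ :=
  Real.exp (∑' n : ℕ, zetaTerm G x t n)

/-- The `d`-dimensional torus graph with `N ^ d` vertices (`N ≥ 1`): two distinct vertices are
adjacent if they agree in all coordinates but one, where they differ by `± 1` modulo `N`. -/
def torus (d N : ℕ) : SimpleGraph (Fin d → ZMod N) where
  Adj v w := v ≠ w ∧
    ∃ k : Fin d, (∀ j, j ≠ k → v j = w j) ∧ (v k - w k = 1 ∨ w k - v k = 1)
  symm := ⟨fun _ _ h => ⟨h.1.symm, h.2.imp fun _ hk => ⟨fun j hj => (hk.1 j hj).symm, hk.2.symm⟩⟩⟩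
  loopless := ⟨fun _ h => h.1 rfl⟩

/-! ### Laurent polynomials and the logarithmic Mahler measure -/

/-- Complex Laurent polynomials in `n` variables. -/
abbrev Laurent (n : ℕ) : Type := AddMonoidAlgebra ℂ (Fin n → ℤ)

/-- The variable `X_j`. -/
def X {n : ℕ} (j : Fin n) : Laurent n := AddMonoidAlgebra.single (Pi.single j 1) 1

/-- The inverse `X_j⁻¹` of the variable `X_j`. -/
def Xinv {n : ℕ} (j : Fin n) : Laurent n := AddMonoidAlgebra.single (Pi.single j (-1)) 1

/-- Evaluation of Laurent polynomials at a point `z` with `|z_1| = ⋯ = |z_n| = 1`. -/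
def eval {n : ℕ} (z : Fin n → Circle) : Laurent n →ₐ[ℂ] ℂ :=
  AddMonoidAlgebra.lift ℂ ℂ (Fin n → ℤ)
    { toFun := fun m => ∏ j, (z j : ℂ) ^ (m.toAdd j)
      map_one' := by simp
      map_mul' := fun a b => by
        simp [zpow_add₀ (Circle.coe_ne_zero _), Finset.prod_mul_distrib] }

/-- The function `s ↦ log |f (e ^ (2 π i s_1), …, e ^ (2 π i s_n))|`. -/
def logAbs {n : ℕ} (f : Laurent n) (s : Fin n → ℝ) : ℝ :=
  Real.log ‖eval (fun j => Circle.exp (2 * Real.pi * s j)) f‖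

/-- The unit cube `[0, 1) ^ n`. -/
def cube (n : ℕ) : Set (Fin n → ℝ) := Set.univ.pi fun _ => Set.Ico 0 1

/-- The logarithmic Mahler measure of a Laurent polynomial. -/
def mahler {n : ℕ} (f : Laurent n) : ℝ := ∫ s in cube n, logAbs f s

end AltZeta

end

/-! The closing condition at the base vertex forces a reduced alternating cycle to have even length
`k`. Such a cycle is then a closed walk without backtracking or tail, together with one of two
choices for the direction of its first arc. On the torus these walks are encoded by cyclically
reduced words in the `2d` unit steps whose displacement is divisible by `N`. The encoding is
injective for every `N` and bijective for `N ≥ 3`. Once `N > k` such a word has displacement zero,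
so each coefficient of the zeta series is eventually the constant `2 C_k` (`k` even) or `0` (`k`
odd), where `C_k` counts the closed cyclically reduced words of `ℤ ^ d`. There are at most `2d
(2d-1)^k` cyclically reduced words, whatever `N` is, so dominated convergence
(`tendsto_tsum_zetaTerm_torus`) gives the limit exponent `∑ C_k / k * (t^k + (-t)^k)`.

Marking each step by its monomial turns `C_k` into the constant Fourier coefficient of `tr
(edgeMatrix z ^ k)`. By `exp_tsum_trace_pow_mul_det`, `∑ C_k u^k / k` is therefore the integral of
`-log |det (1 - u E(z))|`, with `E` the edge matrix (`hasSum_closedWordCount`). The Ihara–Bass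
formula `det_one_sub_smul_edgeMatrix` evaluates the determinant as `(1 - u²)^(d-1) * (-u) * (A(z) -
c(u))`, where `A = ∑ (X_j + X_j⁻¹)` and `c(u) = (2d-1)u + u⁻¹`. The values `u = t` and `u = -t` have
parameters `c` and `-c` and yield the two Mahler measures. Since `c < -2d`, both logarithms are
bounded on the torus. -/

noncomputable section

namespace AltZeta

/-! ### Traces of powers and the determinant -/

section Matrix

variable {ι : Type*} [Fintype ι] [DecidableEq ι]

/-- The entries of a matrix power as sums over words. -/
theorem matrix_pow_apply_eq_sum_words {R : Type*} [CommSemiring R] (A : Matrix ι ι R) (n : ℕ)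
    (a b : ι) :
    (A ^ n) a b = ∑ w : Fin (n + 1) → ι, if w 0 = a ∧ w (Fin.last n) = b then
      ∏ i : Fin n, A (w i.castSucc) (w i.succ) else 0 := by
  induction n generalizing a with
  | zero =>
    rw [← (Equiv.funUnique (Fin 1) ι).symm.sum_comp]
    simp [Matrix.one_apply, Equiv.funUnique, ite_and]
  | succ n ih =>
    rw [pow_succ', Matrix.mul_apply, ← (Fin.consEquiv fun _ : Fin (n + 2) => ι).sum_comp,
      Fintype.sum_prod_type]
    refine Eq.trans ?_ (Finset.sum_eq_single a ?_ ?_).symm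
    · simp_rw [ih, Finset.mul_sum]
      rw [Finset.sum_comm]
      refine Finset.sum_congr rfl fun w _ => ?_
      rw [Finset.sum_eq_single (w 0)]
      · simp [Fin.consEquiv, Fin.prod_univ_succ]
      · intro c _ hc
        simp [Ne.symm hc]
      · simp
    · intro c _ hc
      simp [Fin.consEquiv, hc]
    · simp

/-- The trace of a matrix power as a sum over cyclic words. -/
theorem trace_pow_succ_eq_sum_words {R : Type*} [CommSemiring R] (A : Matrix ι ι R) (n : ℕ) :
    (A ^ (n + 1)).trace = ∑ w : Fin (n + 1) → ι, ∏ i, A (w i) (w (i + 1)) := by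
  have key : (A ^ (n + 1)).trace = ∑ a, ∑ b, ∑ w : Fin (n + 1) → ι,
      if w 0 = a ∧ w (Fin.last n) = b then
        (∏ i : Fin n, A (w i.castSucc) (w i.succ)) * A b a else 0 := by
    rw [Matrix.trace]
    refine Finset.sum_congr rfl fun a _ => ?_
    rw [Matrix.diag_apply, pow_succ, Matrix.mul_apply]
    refine Finset.sum_congr rfl fun b _ => ?_
    simp only [matrix_pow_apply_eq_sum_words, Finset.sum_mul, ite_mul, zero_mul]
  rw [key]
  rw [Finset.sum_congr rfl fun a _ => Finset.sum_comm, Finset.sum_comm]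
  refine Finset.sum_congr rfl fun w _ => ?_
  rw [Finset.sum_eq_single (w 0), Finset.sum_eq_single (w (Fin.last n))]
  · simp [Fin.prod_univ_castSucc]
  · intro b _ hb
    simp [Ne.symm hb]
  · simp
  · intro a _ ha
    simp [Ne.symm ha]
  · simp

theorem hasDerivAt_det_one_add_smul (M : Matrix ι ι ℂ) :
    HasDerivAt (fun h : ℂ => (1 + h • M).det) M.trace 0 := by
  have h := (Matrix.det (1 + (Polynomial.X : Polynomial ℂ) • M.map Polynomial.C)).hasDerivAt 0
  rw [Matrix.derivative_det_one_add_X_smul] at h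
  refine h.congr_of_eventuallyEq (Eventually.of_forall fun x => ?_)
  simp [eval_det, ← Matrix.smul_eq_mul_diagonal]

/-- Jacobi's formula at a general point, reduced to the derivative at `0` by the factorisation `1 -
x M = (1 - u M) (1 - (x - u) R M)`. -/
theorem hasDerivAt_det_one_sub_smul (M R : Matrix ι ι ℂ) (u : ℂ) (hR : (1 - u • M) * R = 1) :
    HasDerivAt (fun x : ℂ => (1 - x • M).det) (-((1 - u • M).det * (R * M).trace)) u := by
  have h1 : HasDerivAt (fun x : ℂ => x - u) 1 u := (hasDerivAt_id u).sub_const u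
  have h2 : HasDerivAt (fun h : ℂ => (1 + h • (-(R * M))).det) (-(R * M)).trace (u - u) := by
    rw [sub_self]; exact hasDerivAt_det_one_add_smul _
  have h3 := (HasDerivAt.comp (h := fun x : ℂ => x - u) u h2 h1).const_mul (1 - u • M).det
  refine (h3.congr_deriv (by simp [Matrix.trace_neg])).congr_of_eventuallyEq
    (Eventually.of_forall fun x => ?_)
  change _ = (1 - u • M).det * (1 + (x - u) • (-(R * M))).det
  rw [← Matrix.det_mul, mul_add, mul_one, Matrix.mul_smul, mul_neg, ← mul_assoc, hR, one_mul]
  refine congrArg Matrix.det ?_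
  module

section Norm

attribute [local instance] Matrix.linftyOpNormedRing Matrix.linftyOpNormedAlgebra

theorem norm_trace_le_card_mul_norm (M : Matrix ι ι ℂ) :
    ‖M.trace‖ ≤ Fintype.card ι * ‖M‖ := by
  have h : ∀ i, ‖M i i‖ ≤ ‖M‖ := fun i => by
    rw [Matrix.linfty_opNorm_def, ← coe_nnnorm, NNReal.coe_le_coe]
    exact (Finset.single_le_sum (f := fun j => ‖M i j‖₊) (fun _ _ => zero_le)
      (Finset.mem_univ i)).trans (Finset.le_sup (f := fun i => ∑ j, ‖M i j‖₊) (Finset.mem_univ i))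
  calc ‖M.trace‖ ≤ ∑ i, ‖M i i‖ := norm_sum_le _ _
    _ ≤ ∑ _i : ι, ‖M‖ := Finset.sum_le_sum fun i _ => h i
    _ = _ := by simp

theorem norm_trace_pow_succ_le (M : Matrix ι ι ℂ) (n : ℕ) :
    ‖(M ^ (n + 1)).trace‖ ≤ Fintype.card ι * ‖M‖ ^ (n + 1) :=
  (norm_trace_le_card_mul_norm _).trans (by gcongr; exact norm_pow_le' _ n.succ_pos)

/-- `det (1 - M) = exp (-∑ tr (M ^ n) / n)` for a matrix of norm less than one. -/
theorem exp_tsum_trace_pow_mul_det (M : Matrix ι ι ℂ) (hM : ‖M‖ < 1) :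
    Complex.exp (∑' n : ℕ, (M ^ (n + 1)).trace / (n + 1)) * (1 - M).det = 1 := by
  -- A radius larger than `1` makes the evaluation point `1` interior to the disc on which the
  -- derivative is computed.
  obtain ⟨r, hr1, hr⟩ : ∃ r : ℝ, 1 < r ∧ r * ‖M‖ < 1 := by
    have h : Tendsto (fun r : ℝ => r * ‖M‖) (𝓝[>] 1) (𝓝 (1 * ‖M‖)) :=
      ((continuous_id.mul continuous_const).tendsto 1).mono_left nhdsWithin_le_nhds
    rw [one_mul] at h
    obtain ⟨r, hr, hr'⟩ := ((h.eventually_lt_const hM).and self_mem_nhdsWithin).exists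
    exact ⟨r, hr', hr⟩
  have hr0 : 0 < r := one_pos.trans hr1
  have hgeom : Summable fun n : ℕ => (Fintype.card ι : ℝ) * ‖M‖ * (r * ‖M‖) ^ n :=
    (summable_geometric_of_lt_one (by positivity) hr).mul_left _
  set F : ℂ → ℂ := fun x => ∑' n : ℕ, (M ^ (n + 1)).trace / (n + 1) * x ^ (n + 1) with hF
  have hball : ∀ x ∈ Metric.ball (0 : ℂ) r, ‖x • M‖ < 1 := fun x hx => by
    rw [norm_smul]
    rw [mem_ball_zero_iff] at hx
    exact (mul_le_mul_of_nonneg_right hx.le (norm_nonneg _)).trans_lt hr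
  have hFd : ∀ x ∈ Metric.ball (0 : ℂ) r,
      HasDerivAt F (∑' n : ℕ, (M ^ (n + 1)).trace * x ^ n) x := by
    intro x hx
    refine hasDerivAt_tsum_of_isPreconnected (F := ℂ) (t := Metric.ball (0 : ℂ) r)
      (g := fun (n : ℕ) (x : ℂ) => (M ^ (n + 1)).trace / (n + 1) * x ^ (n + 1))
      (g' := fun n x => (M ^ (n + 1)).trace * x ^ n) (y₀ := (0 : ℂ)) hgeom Metric.isOpen_ball
      (convex_ball _ _).isPreconnected (fun n y _ => ?_) (fun n y hy => ?_)
      (Metric.mem_ball_self hr0) ?_ hx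
    · refine ((hasDerivAt_pow (n + 1) y).const_mul _).congr_deriv ?_
      have : (n : ℂ) + 1 ≠ 0 := by exact_mod_cast n.succ_ne_zero
      simp only [Nat.add_sub_cancel, Nat.cast_add, Nat.cast_one]
      field_simp
    · rw [mem_ball_zero_iff] at hy
      rw [norm_mul, norm_pow]
      calc _ ≤ (Fintype.card ι * ‖M‖ ^ (n + 1)) * r ^ n := by
            gcongr
            exact norm_trace_pow_succ_le M n
        _ = _ := by rw [mul_pow]; ring
    · simp [summable_zero]
  have hR : ∀ x ∈ Metric.ball (0 : ℂ) r,
      (∑' n : ℕ, (M ^ (n + 1)).trace * x ^ n) = ((∑' n : ℕ, (x • M) ^ n) * M).trace := by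
    intro x hx
    have hs := (summable_geometric_of_norm_lt_one (hball x hx)).hasSum.mul_right M
    have hs' := hs.map (Matrix.traceAddMonoidHom ι ℂ) (by
      change Continuous fun A : Matrix ι ι ℂ => A.trace
      exact continuous_id.matrix_trace)
    refine (HasSum.tsum_eq (hs'.congr_fun ?_))
    intro n
    simp [Matrix.traceAddMonoidHom, smul_pow, pow_succ, mul_comm]
  have hinv : ∀ x ∈ Metric.ball (0 : ℂ) r, (1 - x • M) * (∑' n : ℕ, (x • M) ^ n) = 1 :=
    fun x hx => mul_neg_geom_series _ (hball x hx)
  -- The logarithmic derivatives of the two factors are `tr (R M)` and `-tr (R M)`, with `R` the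
  -- inverse of `1 - x M`. The product is thus constant and can be compared at `1` and `0`.
  have hG : ∀ x ∈ Metric.ball (0 : ℂ) r,
      HasDerivAt (fun x => Complex.exp (F x) * (1 - x • M).det) 0 x := by
    intro x hx
    refine ((hFd x hx).cexp.mul (hasDerivAt_det_one_sub_smul M _ x (hinv x hx))).congr_deriv ?_
    rw [hR x hx]
    ring
  have hconst := (convex_ball (0 : ℂ) r).is_const_of_fderivWithin_eq_zero (𝕜 := ℂ)
    (f := fun x => Complex.exp (F x) * (1 - x • M).det)
    (fun x hx => (hG x hx).differentiableAt.differentiableWithinAt)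
    (fun x hx => by
      rw [fderivWithin_of_isOpen Metric.isOpen_ball hx]
      ext
      simp [(hG x hx).deriv])
    (x := 1) (y := 0) (by simpa using hr1) (Metric.mem_ball_self hr0)
  simpa [hF] using hconst

theorem summable_trace_pow_div (M : Matrix ι ι ℂ) (hM : ‖M‖ < 1) :
    Summable fun n : ℕ => (M ^ (n + 1)).trace / ((n : ℂ) + 1) := by
  refine Summable.of_norm_bounded (g := fun n : ℕ => (Fintype.card ι : ℝ) * ‖M‖ * ‖M‖ ^ n)
    ((summable_geometric_of_lt_one (norm_nonneg _) hM).mul_left _) fun n => ?_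
  have h : ‖(n : ℂ) + 1‖ = n + 1 := by
    rw [← Nat.cast_succ, Complex.norm_natCast, Nat.cast_succ]
  rw [norm_div, h]
  calc _ ≤ ‖(M ^ (n + 1)).trace‖ := div_le_self (norm_nonneg _) (by simp)
    _ ≤ _ := (norm_trace_pow_succ_le M n).trans_eq (by ring)

/-- The logarithm of `|det (1 - M)|` as a series of traces. -/
theorem hasSum_re_trace_pow_div (M : Matrix ι ι ℂ) (hM : ‖M‖ < 1) :
    HasSum (fun n : ℕ => (M ^ (n + 1)).trace.re / ((n : ℝ) + 1))
      (-Real.log ‖(1 - M).det‖) := by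
  have h := Complex.hasSum_re (summable_trace_pow_div M hM).hasSum
  have hd : ‖(1 - M).det‖ =
      Real.exp (-(∑' n : ℕ, (M ^ (n + 1)).trace / ((n : ℂ) + 1)).re) := by
    have := congrArg norm (exp_tsum_trace_pow_mul_det M hM)
    rw [norm_mul, Complex.norm_exp, norm_one] at this
    rw [Real.exp_neg]
    exact eq_inv_of_mul_eq_one_right this
  rw [hd, Real.log_exp, neg_neg]
  refine h.congr_fun fun n => ?_
  have : ((n : ℂ) + 1) = ((n + 1 : ℝ) : ℂ) := by push_cast; rfl
  rw [this, Complex.div_ofReal_re]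

end Norm

end Matrix

/-! ### Steps in the lattice and the twisted edge matrix -/

/-- The unit steps of the lattice `ℤ ^ d`: a direction together with a sign. -/
abbrev Step (d : ℕ) : Type := Bool × Fin d

namespace Step

variable {d : ℕ}

/-- The opposite step. -/
def inv (s : Step d) : Step d := (!s.1, s.2)

/-- The displacement of a step. -/
def vec (s : Step d) : Fin d → ℤ := Pi.single s.2 (if s.1 then 1 else -1)

theorem vec_inv (s : Step d) : s.inv.vec = -s.vec := by
  rcases s with ⟨_ | _, j⟩ <;> simp [inv, vec, ← Pi.single_neg]

end Step

/-- A word in the steps no letter of which is followed, in the cyclic order, by its opposite. -/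
def IsCyclicallyReduced {d n : ℕ} (w : Fin (n + 1) → Step d) : Prop :=
  ∀ i, w (i + 1) ≠ (w i).inv

/-- The value of the monomial with exponent `m` at a point of the torus. -/
def monomial {d : ℕ} (z : Fin d → Circle) (m : Fin d → ℤ) : ℂ := ∏ j, (z j : ℂ) ^ m j

section Monomial

variable {d : ℕ} (z : Fin d → Circle)

@[simp]
theorem monomial_zero : monomial z 0 = 1 := by simp [monomial]

theorem monomial_add (m m' : Fin d → ℤ) :
    monomial z (m + m') = monomial z m * monomial z m' := by
  simp [monomial, zpow_add₀ (Circle.coe_ne_zero _), Finset.prod_mul_distrib]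

theorem monomial_sum {κ : Type*} (s : Finset κ) (m : κ → Fin d → ℤ) :
    monomial z (∑ i ∈ s, m i) = ∏ i ∈ s, monomial z (m i) := by
  classical
  induction s using Finset.induction_on with
  | empty => simp
  | insert a s ha ih => rw [Finset.sum_insert ha, Finset.prod_insert ha, monomial_add, ih]

theorem norm_monomial (m : Fin d → ℤ) : ‖monomial z m‖ = 1 := by
  rw [monomial, norm_prod]
  exact Finset.prod_eq_one fun j _ => by rw [norm_zpow, Circle.norm_coe, one_zpow]

theorem monomial_single (j : Fin d) (k : ℤ) : monomial z (Pi.single j k) = (z j : ℂ) ^ k := by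
  rw [monomial, Finset.prod_eq_single j]
  · simp
  · intro i _ hi
    simp [hi]
  · simp

theorem eval_single (m : Fin d → ℤ) (a : ℂ) :
    eval z (AddMonoidAlgebra.single m a) = a * monomial z m := by
  simp [eval, monomial]

theorem monomial_vec_mul_monomial_vec_inv (s : Step d) :
    monomial z s.vec * monomial z s.inv.vec = 1 := by
  rw [← monomial_add, Step.vec_inv, add_neg_cancel, monomial_zero]

end Monomial

/-- The matrix of transitions between steps without backtracking, weighted by the value of the
step at a point of the torus. -/
def edgeMatrix {d : ℕ} (z : Fin d → Circle) : Matrix (Step d) (Step d) ℂ :=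
  Matrix.of fun a b => if b = a.inv then 0 else monomial z a.vec

/-! ### Traces, determinant and norm of the edge matrix. -/

section EdgeMatrix

variable {d : ℕ} (z : Fin d → Circle)

-- In the expansion of the trace over cyclic words, a backtrack contributes a factor zero, and the
-- weights of a reduced word multiply to the monomial of its displacement.
open scoped Classical in
theorem trace_edgeMatrix_pow_succ (n : ℕ) :
    (edgeMatrix z ^ (n + 1)).trace = ∑ w : Fin (n + 1) → Step d,
      if IsCyclicallyReduced w then monomial z (∑ i, (w i).vec) else 0 := by
  rw [trace_pow_succ_eq_sum_words]
  refine Finset.sum_congr rfl fun w _ => ?_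
  split_ifs with h
  · rw [monomial_sum]
    exact Finset.prod_congr rfl fun i _ => by simp [edgeMatrix, h i]
  · obtain ⟨i, hi⟩ : ∃ i, w (i + 1) = (w i).inv := by
      simpa [IsCyclicallyReduced] using h
    exact Finset.prod_eq_zero (Finset.mem_univ i) (by simp [edgeMatrix, hi])

/-- The value of the adjacency polynomial `∑ (X_j + X_j⁻¹)` at a point of the torus. -/
def adjValue : ℂ := ∑ s : Step d, monomial z s.vec

/-- Without the ban on backtracking the edge matrix would have rank one. The ban only couples a step
with its opposite, so `1 - u E` is a block diagonal matrix `K` with `2 × 2` blocks, perturbed by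
rank one, and the matrix determinant lemma applies. -/
theorem det_one_sub_smul_edgeMatrix_eq_mul (u : ℂ) (hu : 1 - u ^ 2 ≠ 0) :
    (1 - u • edgeMatrix z).det =
      (1 - u ^ 2) ^ d * (1 - u * ((1 - u ^ 2)⁻¹ * (adjValue z - 2 * d * u))) := by
  set K : Matrix (Step d) (Step d) ℂ := Matrix.blockDiagonal fun j =>
    Matrix.of fun a b => if a = b then 1 else u * monomial z (Step.vec (a, j)) with hK
  -- This is the solution of `K x = (monomial z s.vec)_s`, found by inverting each block of
  -- determinant `1 - u ^ 2`.
  set x : Step d → ℂ := fun s => (1 - u ^ 2)⁻¹ * (monomial z s.vec - u) with hx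
  have hKx : K.mulVec x = fun s => monomial z s.vec := by
    ext ⟨a, j⟩
    have h1 := monomial_vec_mul_monomial_vec_inv z (a, j)
    have hsum : K.mulVec x (a, j) = x (a, j) + u * monomial z (Step.vec (a, j)) * x (!a, j) := by
      simp only [Matrix.mulVec, dotProduct, hK, Matrix.blockDiagonal_apply, Fintype.sum_prod_type]
      cases a <;> simp [add_comm]
    rw [hsum]
    simp only [Step.inv] at h1
    simp only [hx]
    field_simp
    linear_combination u * h1
  have hdet : K.det = (1 - u ^ 2) ^ d := by
    rw [hK, Matrix.det_blockDiagonal, Finset.prod_congr rfl (g := fun _ => 1 - u ^ 2)]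
    · simp
    · intro j _
      rw [← Matrix.det_reindex_self finTwoEquiv.symm, Matrix.det_fin_two]
      have h1 := monomial_vec_mul_monomial_vec_inv z (false, j)
      simp only [Step.inv, Bool.not_false] at h1
      simp [finTwoEquiv]
      linear_combination u ^ 2 * h1
  have hmul : 1 - u • edgeMatrix z = K * (1 + Matrix.replicateCol Unit (-u • x) *
      Matrix.replicateRow Unit fun _ : Step d => (1 : ℂ)) := by
    rw [mul_add, mul_one, ← Matrix.mul_assoc, ← Matrix.replicateCol_mulVec, Matrix.mulVec_smul, hKx]
    ext ⟨a, j⟩ ⟨b, k⟩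
    simp only [edgeMatrix, hK, Matrix.sub_apply, Matrix.smul_apply, Matrix.add_apply,
      Matrix.blockDiagonal_apply, Matrix.mul_apply, Matrix.one_apply, Matrix.of_apply, Step.inv,
      Matrix.replicateCol_apply, Matrix.replicateRow_apply, Prod.mk.injEq]
    by_cases hjk : j = k
    · subst hjk
      cases a <;> cases b <;> simp <;> ring
    · simp [hjk, Ne.symm hjk]
  rw [hmul, Matrix.det_mul, hdet, Matrix.det_one_add_replicateCol_mul_replicateRow]
  congr 1
  simp only [dotProduct, one_mul, Pi.smul_apply, smul_eq_mul, hx, ← Finset.mul_sum,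
    Finset.sum_sub_distrib, adjValue]
  simp
  ring

/-- The twisted form of the determinant formula of Ihara and Bass. -/
theorem det_one_sub_smul_edgeMatrix (hd : 1 ≤ d) (u : ℂ) (hu : 1 - u ^ 2 ≠ 0) :
    (1 - u • edgeMatrix z).det =
      (1 - u ^ 2) ^ (d - 1) * (1 - u * adjValue z + (2 * d - 1) * u ^ 2) := by
  obtain ⟨e, rfl⟩ : ∃ e, d = e + 1 := ⟨d - 1, by omega⟩
  rw [det_one_sub_smul_edgeMatrix_eq_mul z u hu, Nat.add_sub_cancel, pow_succ, mul_assoc]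
  congr 1
  field_simp
  ring

theorem adjValue_eq_sum : adjValue z = ∑ j, ((z j : ℂ) + (z j : ℂ)⁻¹) := by
  rw [adjValue, Fintype.sum_prod_type_right]
  simp [Step.vec, monomial_single]

theorem adjValue_eq_ofReal : adjValue z = ((∑ j, 2 * (z j : ℂ).re : ℝ) : ℂ) := by
  rw [adjValue_eq_sum, Complex.ofReal_sum]
  refine Finset.sum_congr rfl fun j _ => ?_
  rw [← Circle.coe_inv, Circle.coe_inv_eq_conj, Complex.add_conj]

section Norm

attribute [local instance] Matrix.linftyOpNormedRing Matrix.linftyOpNormedAlgebra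

/-- Each row has `2d - 1` nonzero entries, all of modulus one. This is the source of the convergence
condition `|u| (2d - 1) < 1`. -/
theorem norm_edgeMatrix_le (hd : 1 ≤ d) : ‖edgeMatrix z‖ ≤ 2 * d - 1 := by
  have h : (Finset.univ.sup fun a : Step d => ∑ b, ‖edgeMatrix z a b‖₊) ≤
      ((2 * d - 1 : ℕ) : NNReal) := by
    refine Finset.sup_le fun a _ => ?_
    have hb : ∀ b, ‖edgeMatrix z a b‖₊ = if b = a.inv then 0 else 1 := fun b => by
      rw [edgeMatrix, Matrix.of_apply]
      split_ifs
      · simp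
      · exact NNReal.eq (norm_monomial z _)
    have hcard : (Finset.univ.filter fun b : Step d => ¬ b = a.inv).card = 2 * d - 1 := by
      rw [Finset.filter_not, Finset.filter_eq' Finset.univ a.inv, if_pos (Finset.mem_univ _),
        Finset.card_sdiff_of_subset (Finset.subset_univ _)]
      simp
    simp_rw [hb]
    rw [Finset.sum_ite]
    simp [hcard]
  rw [Matrix.linfty_opNorm_def]
  refine (NNReal.coe_le_coe.2 h).trans_eq ?_
  rw [NNReal.coe_natCast, Nat.cast_sub (by omega)]
  push_cast
  ring

theorem norm_trace_edgeMatrix_pow_succ_le (hd : 1 ≤ d) (n : ℕ) :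
    ‖(edgeMatrix z ^ (n + 1)).trace‖ ≤ 2 * d * (2 * d - 1) ^ (n + 1) := by
  refine (norm_trace_pow_succ_le _ n).trans ?_
  have := norm_edgeMatrix_le z hd
  simp only [Fintype.card_prod, Fintype.card_bool, Fintype.card_fin, Nat.cast_mul, Nat.cast_ofNat]
  gcongr

end Norm

end EdgeMatrix

/-- The point of the torus with angles `2 π s_j`. -/
def torusPoint {d : ℕ} (s : Fin d → ℝ) : Fin d → Circle := fun j => Circle.exp (2 * Real.pi * s j)

/-! ### Fourier orthogonality on the cube. -/

theorem restrict_cube_eq_pi (d : ℕ) :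
    (volume : Measure (Fin d → ℝ)).restrict (cube d) =
      Measure.pi fun _ => (volume : Measure ℝ).restrict (Set.Ico 0 1) := by
  rw [cube, volume_pi, Measure.restrict_pi_pi]

instance isProbabilityMeasure_restrict_cube (d : ℕ) :
    IsProbabilityMeasure ((volume : Measure (Fin d → ℝ)).restrict (cube d)) := by
  have : IsProbabilityMeasure ((volume : Measure ℝ).restrict (Set.Ico 0 1)) := ⟨by simp⟩
  rw [restrict_cube_eq_pi]
  infer_instance

theorem integral_circleExp_zpow (k : ℤ) :
    ∫ s in Set.Ico (0 : ℝ) 1, (Circle.exp (2 * Real.pi * s) : ℂ) ^ k = if k = 0 then 1 else 0 := by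
  split_ifs with hk
  · simp [hk]
  · have hc : (k : ℂ) * (2 * Real.pi * Complex.I) ≠ 0 := by
      simp [hk, Real.pi_ne_zero, Complex.I_ne_zero]
    have h : ∀ s : ℝ, (Circle.exp (2 * Real.pi * s) : ℂ) ^ k =
        Complex.exp ((k : ℂ) * (2 * Real.pi * Complex.I) * s) := fun s => by
      rw [Circle.coe_exp, ← Complex.exp_int_mul]
      congr 1
      push_cast
      ring
    simp_rw [h]
    rw [integral_Ico_eq_integral_Ioc, ← intervalIntegral.integral_of_le zero_le_one,
      integral_exp_mul_complex hc]
    simp [Complex.exp_int_mul_two_pi_mul_I]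

/-- Orthogonality of the monomials on the torus. -/
theorem integral_monomial {d : ℕ} (m : Fin d → ℤ) :
    ∫ s in cube d, monomial (torusPoint s) m =
      if m = 0 then 1 else 0 := by
  rw [restrict_cube_eq_pi]
  simp only [monomial, torusPoint]
  rw [integral_fintype_prod_eq_prod (𝕜 := ℂ)
    (fun j (s : ℝ) => (Circle.exp (2 * Real.pi * s) : ℂ) ^ m j)]
  simp_rw [integral_circleExp_zpow]
  split_ifs with h
  · simp [h]
  · obtain ⟨j, hj⟩ := Function.ne_iff.1 h
    exact Finset.prod_eq_zero (Finset.mem_univ j) (if_neg hj)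

/-! ### Counting closed words -/

/-- The number of cyclically reduced words of length `n + 1` in the steps whose total displacement
is divisible by `N`. -/
def closedWordCount (d N n : ℕ) : ℕ :=
  Nat.card {w : Fin (n + 1) → Step d //
    IsCyclicallyReduced w ∧ ∀ j, (N : ℤ) ∣ (∑ i, (w i).vec) j}

theorem closedWordCount_le {d : ℕ} (hd : 1 ≤ d) (N n : ℕ) :
    (closedWordCount d N n : ℝ) ≤ 2 * d * (2 * d - 1) ^ (n + 1) := by
  classical
  have h1 : closedWordCount d N n ≤
      (Finset.univ.filter fun w : Fin (n + 1) → Step d => IsCyclicallyReduced w).card := by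
    rw [closedWordCount, Nat.card_eq_fintype_card, Fintype.card_subtype]
    exact Finset.card_le_card fun w hw => by
      simp only [Finset.mem_filter, Finset.mem_univ, true_and] at hw ⊢
      exact hw.1
  -- At `z = 1` every monomial equals `1`, so the trace counts all cyclically reduced words.
  have h2 : (edgeMatrix (1 : Fin d → Circle) ^ (n + 1)).trace =
      (((Finset.univ.filter fun w : Fin (n + 1) → Step d =>
        IsCyclicallyReduced w).card : ℕ) : ℂ) := by
    rw [trace_edgeMatrix_pow_succ]
    simp [monomial]
  have h3 := norm_trace_edgeMatrix_pow_succ_le (1 : Fin d → Circle) hd n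
  rw [h2, Complex.norm_natCast] at h3
  exact (Nat.cast_le.2 h1).trans h3

theorem Step.abs_vec_le_one {d : ℕ} (s : Step d) (j : Fin d) : |s.vec j| ≤ 1 := by
  rcases s with ⟨_ | _, k⟩ <;> by_cases h : j = k <;> simp [vec, h]

/-- A word which is short with respect to `N` is closed modulo `N` only if it is closed. -/
theorem closedWordCount_eq_of_lt {d N n : ℕ} (h : n + 1 < N) :
    closedWordCount d N n = closedWordCount d 0 n := by
  refine Nat.card_congr (Equiv.subtypeEquivRight fun w => and_congr_right fun _ =>
    forall_congr' fun j => ⟨fun hdvd => ?_, fun h0 => ?_⟩)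
  -- A multiple of `N` of absolute value at most `n + 1 < N` vanishes. The target count has `N = 0`,
  -- and divisibility by `0` means being zero.
  · have hle : |(∑ i, (w i).vec) j| ≤ n + 1 := by
      rw [Finset.sum_apply]
      refine (Finset.abs_sum_le_sum_abs _ _).trans
        ((Finset.sum_le_sum fun i _ => (w i).abs_vec_le_one j).trans ?_)
      simp
    rw [Int.eq_zero_of_abs_lt_dvd hdvd (by omega)]
    simp
  · rw [Nat.cast_zero, zero_dvd_iff] at h0
    rw [h0]
    exact dvd_zero _

theorem continuous_monomial_torusPoint {d : ℕ} (m : Fin d → ℤ) :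
    Continuous fun s : Fin d → ℝ => monomial (torusPoint s) m := by
  refine continuous_finsetProd _ fun j _ => Continuous.zpow₀ ?_ _ fun s => ?_
  · exact continuous_subtype_val.comp
      (Circle.exp.continuous.comp (continuous_const.mul (continuous_apply j)))
  · exact Or.inl (Circle.coe_ne_zero _)

theorem continuous_trace_edgeMatrix_pow_succ (d n : ℕ) :
    Continuous fun s : Fin d → ℝ => (edgeMatrix (torusPoint s) ^ (n + 1)).trace := by
  classical
  simp_rw [trace_edgeMatrix_pow_succ]
  refine continuous_finsetSum _ fun w _ => ?_
  split_ifs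
  · exact continuous_monomial_torusPoint _
  · exact continuous_const

theorem integrable_of_continuous_of_bound {d : ℕ} {E : Type*} [NormedAddCommGroup E]
    [SecondCountableTopologyEither (Fin d → ℝ) E]
    {f : (Fin d → ℝ) → E} (hf : Continuous f) (C : ℝ) (hC : ∀ s, ‖f s‖ ≤ C) :
    IntegrableOn f (cube d) :=
  Integrable.of_bound hf.aestronglyMeasurable C (Eventually.of_forall hC)

/-- Orthogonality retains exactly the words of displacement zero, which are the words counted with
`N = 0`. -/
theorem integral_trace_edgeMatrix_pow_succ (d n : ℕ) :
    ∫ s in cube d, (edgeMatrix (torusPoint s) ^ (n + 1)).trace = (closedWordCount d 0 n : ℂ) := by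
  classical
  simp_rw [trace_edgeMatrix_pow_succ]
  rw [integral_finsetSum]
  · have h : ∀ w : Fin (n + 1) → Step d,
        (∫ s in cube d, if IsCyclicallyReduced w then
          monomial (torusPoint s) (∑ i, (w i).vec) else 0) =
        if IsCyclicallyReduced w ∧ ∀ j, ((0 : ℕ) : ℤ) ∣ (∑ i, (w i).vec) j then 1 else 0 := by
      intro w
      by_cases hw : IsCyclicallyReduced w
      · have := integral_monomial (∑ i, (w i).vec)
        simp only [hw, if_true, true_and]
        rw [this]
        simp only [Nat.cast_zero, zero_dvd_iff, funext_iff, Pi.zero_apply]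
      · simp [hw]
    simp_rw [h]
    rw [closedWordCount, Nat.card_eq_fintype_card, Fintype.card_subtype]
    simp
  · intro w _
    split_ifs
    · exact integrable_of_continuous_of_bound (continuous_monomial_torusPoint _) 1
        fun s => (norm_monomial _ _).le
    · exact integrable_zero _ _ _

attribute [local instance] Matrix.linftyOpNormedRing Matrix.linftyOpNormedAlgebra in
theorem hasSum_trace_edgeMatrix {d : ℕ} (hd : 1 ≤ d) {u : ℝ} (hu : |u| * (2 * d - 1) < 1)
    (z : Fin d → Circle) :
    HasSum (fun n : ℕ => (edgeMatrix z ^ (n + 1)).trace.re / (n + 1) * u ^ (n + 1))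
      (-Real.log ‖(1 - (u : ℂ) • edgeMatrix z).det‖) := by
  have hn : ‖(u : ℂ) • edgeMatrix z‖ < 1 := by
    rw [norm_smul, Complex.norm_real, Real.norm_eq_abs]
    exact (mul_le_mul_of_nonneg_left (norm_edgeMatrix_le z hd) (abs_nonneg u)).trans_lt hu
  refine (hasSum_re_trace_pow_div _ hn).congr_fun fun n => ?_
  rw [smul_pow, Matrix.trace_smul, ← Complex.ofReal_pow, smul_eq_mul, Complex.re_ofReal_mul]
  ring

/-- The generating series of the closed words as an integral over the torus. -/
theorem hasSum_closedWordCount {d : ℕ} (hd : 1 ≤ d) {u : ℝ} (hu : |u| * (2 * d - 1) < 1) :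
    HasSum (fun n : ℕ => (closedWordCount d 0 n : ℝ) / (n + 1) * u ^ (n + 1))
      (∫ s in cube d, -Real.log ‖(1 - (u : ℂ) • edgeMatrix (torusPoint s)).det‖) := by
  have hd' : (0 : ℝ) ≤ 2 * d - 1 := by
    have : (1 : ℝ) ≤ d := by exact_mod_cast hd
    linarith
  have hcont : ∀ n : ℕ, Continuous fun s : Fin d → ℝ =>
      (edgeMatrix (torusPoint s) ^ (n + 1)).trace.re / (n + 1) * u ^ (n + 1) := fun n =>
    ((Complex.continuous_re.comp (continuous_trace_edgeMatrix_pow_succ d n)).div_const _).mul_const _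
  have hbound : ∀ (n : ℕ) (s : Fin d → ℝ),
      ‖(edgeMatrix (torusPoint s) ^ (n + 1)).trace.re / (n + 1) * u ^ (n + 1)‖ ≤
        2 * d * (|u| * (2 * d - 1)) ^ (n + 1) := fun n s => by
    rw [norm_mul, norm_div, norm_pow, Real.norm_eq_abs u, mul_pow]
    have h1 : ‖(n : ℝ) + 1‖ = n + 1 := by
      rw [Real.norm_eq_abs, abs_of_pos (by positivity)]
    rw [h1]
    calc _ ≤ ‖(edgeMatrix (torusPoint s) ^ (n + 1)).trace.re‖ * |u| ^ (n + 1) := by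
          gcongr
          exact div_le_self (norm_nonneg _) (by simp)
      _ ≤ (2 * d * (2 * d - 1) ^ (n + 1)) * |u| ^ (n + 1) := by
          gcongr
          exact (Complex.abs_re_le_norm _).trans (norm_trace_edgeMatrix_pow_succ_le _ hd n)
      _ = _ := by ring
  have hint := fun n => integrable_of_continuous_of_bound (hcont n) _ (hbound n)
  have hgeom : Summable fun n : ℕ => 2 * d * (|u| * (2 * d - 1)) ^ (n + 1) :=
    ((summable_nat_add_iff 1).2
      (summable_geometric_of_lt_one (mul_nonneg (abs_nonneg u) hd') hu)).mul_left _
  -- The geometric bound is uniform over the torus, which permits the exchange of sum and integral.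
  have hsum := hasSum_integral_of_summable_integral_norm hint
    (Summable.of_nonneg_of_le (fun n => integral_nonneg fun s => norm_nonneg _) (fun n => by
      refine (integral_mono (hint n).norm (integrable_const _) (hbound n)).trans_eq ?_
      simp) hgeom)
  simp_rw [(hasSum_trace_edgeMatrix hd hu _).tsum_eq] at hsum
  refine hsum.congr_fun fun n => ?_
  rw [integral_mul_const, integral_div]
  have h := integral_trace_edgeMatrix_pow_succ d n
  have hre : ∫ s in cube d, (edgeMatrix (torusPoint s) ^ (n + 1)).trace.re =
      (∫ s in cube d, (edgeMatrix (torusPoint s) ^ (n + 1)).trace).re :=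
    integral_re (𝕜 := ℂ) (integrable_of_continuous_of_bound
      (continuous_trace_edgeMatrix_pow_succ d n) _
      fun s => norm_trace_edgeMatrix_pow_succ_le _ hd n)
  rw [hre, h, Complex.natCast_re]

/-! ### Reduced alternating cycles and closed walks -/

/-- A closed walk at `x` of length `n + 1` without backtracking and tail, given by its
vertices. -/
structure IsReducedClosedWalk {V : Type*} (G : SimpleGraph V) (x : V) {n : ℕ}
    (v : Fin (n + 1 + 1) → V) : Prop where
  start : v 0 = x
  finish : v (Fin.last (n + 1)) = x
  adj : ∀ i : Fin (n + 1), G.Adj (v i.castSucc) (v i.succ)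
  reduced : ∀ i : Fin n, v i.succ.succ ≠ v i.castSucc.castSucc
  tailless : v (Fin.last n).castSucc ≠ v (Fin.succ 0)

theorem AltWalk.adj_vert {V : Type*} {G : SimpleGraph V} {r : ℕ} (P : AltWalk (symDigraph G) r)
    (i : Fin r) : G.Adj (P.vert i.castSucc) (P.vert i.succ) := by
  have h := P.adj i
  simp only [altArc, symDigraph] at h
  split_ifs at h
  · exact h
  · exact h.symm

/-- Consecutive arcs have their common vertex in the same role, both as origin or both as terminus,
so they coincide exactly when their other ends do. -/
theorem AltWalk.hasBacktracking_iff {V : Type*} {G : SimpleGraph V} {n : ℕ}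
    (P : AltWalk (symDigraph G) (n + 1)) :
    P.HasBacktracking ↔ ∃ i : Fin n, P.vert i.succ.succ = P.vert i.castSucc.castSucc := by
  refine exists_congr fun i => ?_
  simp only [arc, altArc, Fin.val_succ, Fin.val_castSucc, Nat.even_add_one,
    Fin.succ_castSucc]
  by_cases h : Even (i : ℕ) <;> cases P.out <;> simp [h]

/-- The length is `n + 1`, so `Odd n` says that it is even. Only then are the first and last arcs
oppositely directed along the walk, hence in the same role at `x`. -/
theorem AltWalk.isCycleAt_isReduced_iff {V : Type*} {G : SimpleGraph V} {n : ℕ}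
    (P : AltWalk (symDigraph G) (n + 1)) (x : V) :
    P.IsCycleAt x ∧ P.IsReduced ↔ Odd n ∧ IsReducedClosedWalk G x P.vert := by
  have h0 := (P.adj_vert 0).ne
  have hl := (P.adj_vert (Fin.last n)).ne
  rw [Fin.succ_last] at hl
  rw [Fin.castSucc_zero] at h0
  have hcyc : P.IsCycleAt x ↔ Odd n ∧ P.vert 0 = x ∧ P.vert (Fin.last (n + 1)) = x := by
    rw [IsCycleAt]
    constructor
    · rintro ⟨hs, hf, h⟩
      refine ⟨?_, hs, hf⟩
      rw [← Nat.not_even_iff_odd]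
      intro hn
      -- For even `n` the first and last arcs point the same way along the walk, so a common role at
      -- `x` would make one of them a loop.
      rw [hs] at h0
      rw [hf] at hl
      cases ho : P.out <;> simp [arc, altArc, ho, hn, hl] at h <;> exact h0 h.1.symm
    · rintro ⟨hn, hs, hf⟩
      rw [← Nat.not_even_iff_odd] at hn
      refine ⟨hs, hf, ?_⟩
      cases ho : P.out <;> simp [arc, altArc, ho, hn, hs, hf]
  have htail : Odd n → P.vert 0 = x → P.vert (Fin.last (n + 1)) = x →
      (P.HasTail ↔ P.vert (Fin.last n).castSucc = P.vert (Fin.succ 0)) := by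
    intro hn hs hf
    rw [← Nat.not_even_iff_odd] at hn
    rw [HasTail]
    cases ho : P.out <;> simp [arc, altArc, ho, hn, hs, hf]
  rw [hcyc, IsReduced, hasBacktracking_iff]
  constructor
  · rintro ⟨⟨hn, hs, hf⟩, hb, ht⟩
    exact ⟨hn, hs, hf, P.adj_vert, fun i hi => hb ⟨i, hi⟩, fun h => ht ((htail hn hs hf).2 h)⟩
  · rintro ⟨hn, h⟩
    exact ⟨⟨hn, h.start, h.finish⟩, fun ⟨i, hi⟩ => h.reduced i hi,
      fun ht => h.tailless ((htail hn h.start h.finish).1 ht)⟩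

/-- A walk in a graph, with a choice of the direction of the first arc, as an alternating walk. -/
def altWalkOfVert {V : Type*} {G : SimpleGraph V} {r : ℕ} (out : Bool) (v : Fin (r + 1) → V)
    (h : ∀ i : Fin r, G.Adj (v i.castSucc) (v i.succ)) : AltWalk (symDigraph G) r where
  out := out
  vert := v
  adj i := by
    simp only [altArc, symDigraph]
    split_ifs
    · exact h i
    · exact (h i).symm

/-- The number of reduced alternating cycles in terms of closed walks in the graph. -/
theorem numReducedCycles_eq {V : Type*} (G : SimpleGraph V) (x : V) (n : ℕ) :
    numReducedCycles G x n = if Odd n then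
      2 * Nat.card {v : Fin (n + 1 + 1) → V // IsReducedClosedWalk G x v} else 0 := by
  rw [numReducedCycles]
  split_ifs with hn
  · have e : {P : AltWalk (symDigraph G) (n + 1) // P.IsCycleAt x ∧ P.IsReduced} ≃
        Bool × {v : Fin (n + 1 + 1) → V // IsReducedClosedWalk G x v} :=
      { toFun := fun P => (P.1.out, ⟨P.1.vert, ((P.1.isCycleAt_isReduced_iff x).1 P.2).2⟩)
        invFun := fun q => ⟨altWalkOfVert q.1 q.2.1 q.2.2.adj,
          ((altWalkOfVert q.1 q.2.1 q.2.2.adj).isCycleAt_isReduced_iff x).2 ⟨hn, q.2.2⟩⟩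
        left_inv := fun _ => rfl
        right_inv := fun _ => rfl }
    rw [Nat.card_congr e, Nat.card_prod]
    simp
  · have : IsEmpty {P : AltWalk (symDigraph G) (n + 1) // P.IsCycleAt x ∧ P.IsReduced} :=
      ⟨fun P => hn ((P.1.isCycleAt_isReduced_iff x).1 P.2).1⟩
    exact Nat.card_of_isEmpty

/-! ### Closed walks in the torus and closed words -/

theorem apply_last_eq_add_sum {A : Type*} [AddCommMonoid A] {n : ℕ} (v : Fin (n + 1) → A)
    (f : Fin n → A) (h : ∀ i, v i.succ = v i.castSucc + f i) :
    v (Fin.last n) = v 0 + ∑ i, f i := by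
  induction n with
  | zero => simp
  | succ n ih =>
    have := ih (fun i => v i.castSucc) (fun i => f i.castSucc) fun i => h i.castSucc
    rw [Fin.sum_univ_castSucc, ← add_assoc, ← Fin.succ_last, h (Fin.last n), this]
    rfl

theorem isCyclicallyReduced_iff {d n : ℕ} (w : Fin (n + 1) → Step d) :
    IsCyclicallyReduced w ↔
      (∀ i : Fin n, w i.succ ≠ (w i.castSucc).inv) ∧ w 0 ≠ (w (Fin.last n)).inv := by
  rw [IsCyclicallyReduced, Fin.forall_fin_succ']
  simp

/-- The displacement of a step modulo `N`. -/
def Step.vecMod {d : ℕ} (N : ℕ) (s : Step d) : Fin d → ZMod N := fun j => (s.vec j : ZMod N)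

section Torus

variable {d N : ℕ}

theorem Step.vecMod_inv (s : Step d) : s.inv.vecMod N = -s.vecMod N := by
  ext j
  simp [vecMod, vec_inv]

theorem Step.vecMod_mk (b : Bool) (k : Fin d) :
    Step.vecMod N (b, k) = Pi.single k (if b then 1 else -1) := by
  ext j
  by_cases h : j = k
  · subst h
    cases b <;> simp [vecMod, vec]
  · simp [vecMod, vec, h]

theorem sum_vecMod_eq_zero_iff {n : ℕ} (w : Fin n → Step d) :
    ∑ i, (w i).vecMod N = 0 ↔ ∀ j, (N : ℤ) ∣ (∑ i, (w i).vec) j := by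
  rw [funext_iff]
  refine forall_congr' fun j => ?_
  rw [← CharP.intCast_eq_zero_iff (ZMod N) N]
  simp [Step.vecMod]

theorem exists_step_of_torus_adj {v w : Fin d → ZMod N} (h : (torus d N).Adj v w) :
    ∃ s : Step d, w = v + s.vecMod N := by
  obtain ⟨_, k, hk, h1 | h1⟩ := h
  · refine ⟨(false, k), ?_⟩
    rw [Step.vecMod_mk]
    ext j
    by_cases hj : j = k
    · subst hj
      simp [← h1]
    · simp [hj, hk j hj]
  · refine ⟨(true, k), ?_⟩
    rw [Step.vecMod_mk]
    ext j
    by_cases hj : j = k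
    · subst hj
      simp [← h1]
    · simp [hj, hk j hj]

/-- The bound is what makes `0`, `1` and `-1` distinct modulo `N`; for `N = 2` opposite steps
coincide. -/
theorem Step.vecMod_injective (hN : 3 ≤ N) : Function.Injective (Step.vecMod (d := d) N) := by
  have h1 : (1 : ZMod N) ≠ 0 := by
    have : Fact (1 < N) := ⟨by omega⟩
    exact one_ne_zero
  have h2 : (1 : ZMod N) ≠ -1 := by
    have : Fact (2 < N) := ⟨by omega⟩
    exact (ZMod.neg_one_ne_one).symm
  rintro ⟨a, j⟩ ⟨b, k⟩ h
  rw [vecMod_mk, vecMod_mk] at h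
  have hj := congrFun h j
  by_cases hjk : j = k
  · subst hjk
    cases a <;> cases b <;> simp_all
  · rw [Pi.single_eq_same, Pi.single_eq_of_ne hjk] at hj
    cases a <;> simp_all

theorem torus_adj_add_vecMod (hN : 2 ≤ N) (v : Fin d → ZMod N) (s : Step d) :
    (torus d N).Adj v (v + s.vecMod N) := by
  have h1 : (1 : ZMod N) ≠ 0 := by
    have : Fact (1 < N) := ⟨by omega⟩
    exact one_ne_zero
  obtain ⟨b, k⟩ := s
  rw [Step.vecMod_mk]
  refine ⟨fun h => ?_, k, fun j hj => by simp [hj], ?_⟩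
  · have := congrFun h k
    cases b <;> simp_all
  · cases b <;> simp

/-- One word is chosen for each walk; with the starting point it recovers the walk. No condition on
`N` is needed, so this also gives summability for `N ≤ 2`, where a walk may come from several words.
-/
theorem card_isReducedClosedWalk_torus_le (x : Fin d → ZMod N) (n : ℕ) :
    Nat.card {v : Fin (n + 1 + 1) → Fin d → ZMod N // IsReducedClosedWalk (torus d N) x v} ≤
      closedWordCount d N n := by
  choose w hw using fun (v : {v : Fin (n + 1 + 1) → Fin d → ZMod N //
    IsReducedClosedWalk (torus d N) x v}) (i : Fin (n + 1)) =>
      exists_step_of_torus_adj (v.2.adj i)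
  have hmem : ∀ v, IsCyclicallyReduced (w v) ∧ ∀ j, (N : ℤ) ∣ (∑ i, (w v i).vec) j := by
    intro v
    refine ⟨(isCyclicallyReduced_iff _).2 ⟨fun i hi => v.2.reduced i ?_, fun h => v.2.tailless ?_⟩,
      (sum_vecMod_eq_zero_iff _).1 ?_⟩
    · rw [hw v i.succ, hi, Step.vecMod_inv, ← Fin.succ_castSucc, hw v i.castSucc]
      simp
    · have h1 := hw v (Fin.last n)
      have h2 := hw v 0
      rw [Fin.succ_last, v.2.finish] at h1
      rw [Fin.castSucc_zero, v.2.start, h, Step.vecMod_inv] at h2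
      rw [h2]
      exact eq_add_neg_of_add_eq h1.symm
    · have := apply_last_eq_add_sum v.1 _ (hw v)
      rw [v.2.start, v.2.finish] at this
      exact left_eq_add.1 this
  refine Nat.card_le_card_of_injective (fun v => ⟨w v, hmem v⟩) fun v v' h => ?_
  have hww : w v = w v' := congrArg Subtype.val h
  refine Subtype.ext (funext fun i => ?_)
  induction i using Fin.induction with
  | zero => rw [v.2.start, v'.2.start]
  | succ i ih => rw [hw v i, hw v' i, ih, hww]

/-- The partial sums of a word form a walk. For `N ≥ 3` distinct steps have distinct displacements,
so a backtrack or tail of the walk would be a cancellation in the word. -/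
theorem closedWordCount_le_card_isReducedClosedWalk_torus (hN : 3 ≤ N) (x : Fin d → ZMod N)
    (n : ℕ) : closedWordCount d N n ≤
      Nat.card {v : Fin (n + 1 + 1) → Fin d → ZMod N // IsReducedClosedWalk (torus d N) x v} := by
  -- The vertex set must be finite for `Nat.card` to be monotone under injections.
  have : NeZero N := ⟨by omega⟩
  set v : (Fin (n + 1) → Step d) → Fin (n + 1 + 1) → Fin d → ZMod N := fun w i =>
    x + Fin.partialSum (fun i => (w i).vecMod N) i with hv
  have hstep : ∀ w i, v w i.succ = v w i.castSucc + (w i).vecMod N := fun w i => by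
    simp only [hv]
    rw [Fin.partialSum_succ, add_assoc]
  have hstart : ∀ w, v w 0 = x := fun w => by simp [hv]
  have hmem : ∀ w : {w : Fin (n + 1) → Step d //
      IsCyclicallyReduced w ∧ ∀ j, (N : ℤ) ∣ (∑ i, (w i).vec) j},
      IsReducedClosedWalk (torus d N) x (v w.1) := by
    rintro ⟨w, hw, hsum⟩
    rw [isCyclicallyReduced_iff] at hw
    rw [← sum_vecMod_eq_zero_iff] at hsum
    have hfin : v w (Fin.last (n + 1)) = x := by
      rw [apply_last_eq_add_sum _ _ (hstep w), hstart, hsum, add_zero]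
    refine ⟨hstart w, hfin, fun i => ?_, fun i hi => hw.1 i ?_, fun h => hw.2 ?_⟩
    · rw [hstep]
      exact torus_adj_add_vecMod (by omega) _ _
    · apply Step.vecMod_injective hN
      rw [hstep, ← Fin.succ_castSucc, hstep, add_assoc, add_eq_left] at hi
      rw [Step.vecMod_inv]
      exact eq_neg_of_add_eq_zero_right hi
    · apply Step.vecMod_injective hN
      have h1 := hstep w (Fin.last n)
      have h2 := hstep w 0
      rw [Fin.succ_last, hfin, h, h2, Fin.castSucc_zero, hstart, add_assoc, left_eq_add] at h1
      rw [Step.vecMod_inv]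
      exact eq_neg_of_add_eq_zero_left h1
  refine Nat.card_le_card_of_injective (fun w => ⟨v w.1, hmem w⟩) fun w w' h => ?_
  have hvv : v w.1 = v w'.1 := congrArg Subtype.val h
  refine Subtype.ext (funext fun i => Step.vecMod_injective hN ?_)
  have h1 := hstep w.1 i
  rw [hvv, hstep w'.1 i] at h1
  exact (add_left_cancel h1).symm

theorem numReducedCycles_torus_le (x : Fin d → ZMod N) (n : ℕ) :
    numReducedCycles (torus d N) x n ≤ 2 * closedWordCount d N n := by
  rw [numReducedCycles_eq]
  split_ifs
  · exact Nat.mul_le_mul_left 2 (card_isReducedClosedWalk_torus_le x n)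
  · exact Nat.zero_le _

theorem numReducedCycles_torus_eq (hN : 3 ≤ N) (x : Fin d → ZMod N) (n : ℕ) :
    numReducedCycles (torus d N) x n = if Odd n then 2 * closedWordCount d N n else 0 := by
  rw [numReducedCycles_eq, (card_isReducedClosedWalk_torus_le x n).antisymm
    (closedWordCount_le_card_isReducedClosedWalk_torus hN x n)]

end Torus

/-! ### The limit of the zeta functions -/

section Limit

variable {d : ℕ}

/-- The bound does not depend on `N`, so it serves both for summability and as the dominating series
in the limit. -/
theorem norm_zetaTerm_torus_le (hd : 1 ≤ d) (N : ℕ) (x : Fin d → ZMod N) (t : ℝ) (n : ℕ) :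
    ‖zetaTerm (torus d N) x t n‖ ≤ 4 * d * (|t| * (2 * d - 1)) ^ (n + 1) := by
  have h1 : (numReducedCycles (torus d N) x n : ℝ) ≤ 4 * d * (2 * d - 1) ^ (n + 1) :=
    calc (numReducedCycles (torus d N) x n : ℝ) ≤ ((2 * closedWordCount d N n : ℕ) : ℝ) :=
          Nat.cast_le.2 (numReducedCycles_torus_le x n)
      _ = 2 * closedWordCount d N n := by push_cast; rfl
      _ ≤ 2 * (2 * d * (2 * d - 1) ^ (n + 1)) := by
          gcongr
          exact closedWordCount_le hd N n
      _ = _ := by ring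
  rw [zetaTerm, norm_mul, norm_div, norm_pow, Real.norm_natCast, Real.norm_natCast,
    Real.norm_eq_abs, mul_pow]
  calc _ ≤ (numReducedCycles (torus d N) x n : ℝ) * |t| ^ (n + 1) := by
        gcongr
        exact div_le_self (Nat.cast_nonneg _) (by simp)
    _ ≤ (4 * d * (2 * d - 1) ^ (n + 1)) * |t| ^ (n + 1) := by gcongr
    _ = _ := by ring

theorem summable_zetaTerm_bound (hd : 1 ≤ d) {t : ℝ} (ht : |t| * (2 * d - 1) < 1) :
    Summable fun n : ℕ => 4 * d * (|t| * (2 * d - 1)) ^ (n + 1) := by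
  have hd' : (1 : ℝ) ≤ d := by exact_mod_cast hd
  exact ((summable_nat_add_iff 1).2 (summable_geometric_of_lt_one
    (mul_nonneg (abs_nonneg t) (by linarith)) ht)).mul_left _

/-- For a fixed length the term of the zeta series is eventually that of the infinite lattice. -/
theorem zetaTerm_torus_eq {N n : ℕ} (hN : 3 ≤ N) (hn : n + 1 < N) (x : Fin d → ZMod N) (t : ℝ) :
    zetaTerm (torus d N) x t n =
      (closedWordCount d 0 n : ℝ) / (n + 1) * t ^ (n + 1) +
        (closedWordCount d 0 n : ℝ) / (n + 1) * (-t) ^ (n + 1) := by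
  rw [zetaTerm, numReducedCycles_torus_eq hN, closedWordCount_eq_of_lt hn]
  -- The powers of `t` and `-t` agree at even length `n + 1` and cancel at odd length: the factor
  -- `2` and the parity condition are both absorbed.
  split_ifs with h
  · rw [(Odd.add_one h).neg_pow]
    push_cast
    ring
  · rw [((Nat.not_odd_iff_even.1 h).add_one).neg_pow]
    simp

theorem tendsto_tsum_zetaTerm_torus (hd : 1 ≤ d) {t : ℝ} (ht : |t| * (2 * d - 1) < 1)
    (x : ∀ N : ℕ, Fin d → ZMod N) :
    Tendsto (fun N : ℕ => ∑' n, zetaTerm (torus d N) (x N) t n) atTop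
      (𝓝 ((∫ s in cube d, -Real.log ‖(1 - (t : ℂ) • edgeMatrix (torusPoint s)).det‖) +
        ∫ s in cube d, -Real.log ‖(1 - ((-t : ℝ) : ℂ) • edgeMatrix (torusPoint s)).det‖)) := by
  have hsum := (hasSum_closedWordCount hd ht).add
    (hasSum_closedWordCount hd (u := -t) (by rwa [abs_neg]))
  rw [← hsum.tsum_eq]
  refine tendsto_tsum_of_dominated_convergence (summable_zetaTerm_bound hd ht) (fun n => ?_)
    (Eventually.of_forall fun N n => norm_zetaTerm_torus_le hd N (x N) t n)
  refine tendsto_const_nhds.congr' ?_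
  filter_upwards [eventually_ge_atTop 3, eventually_gt_atTop (n + 1)] with N hN hn
  exact (zetaTerm_torus_eq hN hn (x N) t).symm

end Limit

/-! ### The Mahler measures -/

section Mahler

variable {d : ℕ}

/-- The function `∑ 2 cos (2 π s_j)`. -/
def cosSum (s : Fin d → ℝ) : ℝ := ∑ j, 2 * Real.cos (2 * Real.pi * s j)

theorem continuous_cosSum : Continuous (cosSum (d := d)) := by
  unfold cosSum
  fun_prop

theorem abs_cosSum_le (s : Fin d → ℝ) : |cosSum s| ≤ 2 * d := by
  refine (Finset.abs_sum_le_sum_abs _ _).trans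
    ((Finset.sum_le_sum (g := fun _ => (2 : ℝ)) fun j _ => ?_).trans ?_)
  · rw [abs_mul, abs_two]
    linarith [Real.abs_cos_le_one (2 * Real.pi * s j)]
  · simp [mul_comm]

theorem adjValue_torusPoint (s : Fin d → ℝ) : adjValue (torusPoint s) = (cosSum s : ℂ) := by
  rw [adjValue_eq_ofReal, cosSum]
  refine congrArg Complex.ofReal (Finset.sum_congr rfl fun j _ => ?_)
  rw [torusPoint, Circle.coe_exp, Complex.exp_ofReal_mul_I_re]

theorem eval_sum_X_add_Xinv (z : Fin d → Circle) :
    eval z (∑ j : Fin d, (X j + Xinv j)) = adjValue z := by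
  rw [adjValue_eq_sum, map_sum]
  simp [X, Xinv, eval_single, monomial_single]

theorem logAbs_sum_sub (c : ℝ) (s : Fin d → ℝ) :
    logAbs ((∑ j : Fin d, (X j + Xinv j)) - algebraMap ℂ (Laurent d) (c : ℂ)) s =
      Real.log |cosSum s - c| := by
  have h : adjValue (fun j => Circle.exp (2 * Real.pi * s j)) = (cosSum s : ℂ) :=
    adjValue_torusPoint s
  rw [logAbs, map_sub, eval_sum_X_add_Xinv, AlgHom.commutes, h, Algebra.algebraMap_self_apply,
    ← Complex.ofReal_sub, Complex.norm_real, Real.norm_eq_abs]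

theorem logAbs_neg_sum_sub (c : ℝ) (s : Fin d → ℝ) :
    logAbs (-(∑ j : Fin d, (X j + Xinv j)) - algebraMap ℂ (Laurent d) (c : ℂ)) s =
      Real.log |-cosSum s - c| := by
  have h : adjValue (fun j => Circle.exp (2 * Real.pi * s j)) = (cosSum s : ℂ) :=
    adjValue_torusPoint s
  rw [logAbs, map_sub, map_neg, eval_sum_X_add_Xinv, AlgHom.commutes, h,
    Algebra.algebraMap_self_apply, ← Complex.ofReal_neg, ← Complex.ofReal_sub, Complex.norm_real,
    Real.norm_eq_abs]

/-- A continuous function with values in a compact interval of positive numbers has an integrable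
logarithm. -/
theorem integrableOn_log_abs {f : (Fin d → ℝ) → ℝ} (hf : Continuous f) {a b : ℝ} (ha : 0 < a)
    (h : ∀ s, f s ∈ Set.Icc a b) : IntegrableOn (fun s => Real.log |f s|) (cube d) := by
  have hpos : ∀ s, 0 < f s := fun s => ha.trans_le (h s).1
  refine integrable_of_continuous_of_bound
    (hf.abs.log fun s => abs_ne_zero.2 (hpos s).ne') (max |Real.log a| |Real.log b|) fun s => ?_
  rw [abs_of_pos (hpos s), Real.norm_eq_abs]
  exact abs_le_max_abs_abs (Real.log_le_log ha (h s).1) (Real.log_le_log (hpos s) (h s).2)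

theorem log_norm_det_one_sub_smul_edgeMatrix (hd : 1 ≤ d) {u c : ℝ} (hu : u ≠ 0)
    (hu1 : 0 < 1 - u ^ 2) (hc : c = (2 * (d : ℝ) - 1) * u + u⁻¹) (s : Fin d → ℝ)
    (hs : cosSum s - c ≠ 0) :
    Real.log ‖(1 - (u : ℂ) • edgeMatrix (torusPoint s)).det‖ =
      ((d : ℝ) - 1) * Real.log (1 - u ^ 2) + Real.log u + Real.log |cosSum s - c| := by
  have hu1' : (1 : ℂ) - (u : ℂ) ^ 2 ≠ 0 := by exact_mod_cast hu1.ne'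
  -- The parameter `c` is chosen so that the Ihara–Bass quadratic becomes `-u` times a translate of
  -- the adjacency value.
  have hfac : 1 - u * cosSum s + (2 * d - 1) * u ^ 2 = -u * (cosSum s - c) := by
    rw [hc]
    field_simp
    ring
  have hdet : (1 - (u : ℂ) • edgeMatrix (torusPoint s)).det =
      (((1 - u ^ 2) ^ (d - 1) * (-u * (cosSum s - c)) : ℝ) : ℂ) := by
    rw [det_one_sub_smul_edgeMatrix _ hd _ hu1', adjValue_torusPoint, ← hfac]
    push_cast
    rfl
  -- `Real.log` is even, so the term `Real.log u` stands for `log |u|` and the sign of `u` is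
  -- irrelevant.
  rw [hdet, Complex.norm_real, Real.norm_eq_abs, Real.log_abs,
    Real.log_mul (pow_ne_zero _ hu1.ne') (mul_ne_zero (neg_ne_zero.2 hu) hs), Real.log_pow,
    Real.log_mul (neg_ne_zero.2 hu) hs, Real.log_neg_eq_log, Real.log_abs, Nat.cast_sub hd]
  push_cast
  ring

theorem integral_log_norm_det (hd : 1 ≤ d) {u c : ℝ} (hu : u ≠ 0)
    (hu1 : 0 < 1 - u ^ 2) (hc : c = (2 * (d : ℝ) - 1) * u + u⁻¹)
    (hs : ∀ s : Fin d → ℝ, cosSum s - c ≠ 0)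
    (hint : IntegrableOn (fun s : Fin d → ℝ => Real.log |cosSum s - c|) (cube d)) :
    ∫ s in cube d, -Real.log ‖(1 - (u : ℂ) • edgeMatrix (torusPoint s)).det‖ =
      -(((d : ℝ) - 1) * Real.log (1 - u ^ 2) + Real.log u +
        ∫ s in cube d, Real.log |cosSum s - c|) := by
  simp_rw [log_norm_det_one_sub_smul_edgeMatrix hd hu hu1 hc _ (hs _)]
  rw [integral_neg, integral_add (integrable_const _) hint]
  simp

/-- In the range of convergence `c` lies below the spectrum `[-2d, 2d]`. -/
theorem add_lt_neg_two_mul {q t : ℝ} (hq : 1 ≤ q) (ht : -1 < t * q) (ht0 : t < 0) :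
    q * t + t⁻¹ < -(q + 1) := by
  -- Multiplication by `t` clears the inverse and leaves a product of two positive factors; as `t <
  -- 0`, the sum in parentheses is negative.
  have h : (q * t + t⁻¹ + (q + 1)) * t = (q * t + 1) * (t + 1) := by
    linear_combination inv_mul_cancel₀ ht0.ne
  have h1 : 0 < t + 1 := by nlinarith
  have h2 : 0 < (q * t + t⁻¹ + (q + 1)) * t := h ▸ mul_pos (by linarith) h1
  linarith [neg_of_mul_pos_left h2 ht0.le]

end Mahler

end AltZeta
end

/-! ### The main theorem. -/

open AltZeta in
theorem theorem12 (d : ℕ) (hd : 1 ≤ d) (t c : ℝ)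
    (ht : -1 / (2 * (d : ℝ) - 1) < t) (ht0 : t < 0)
    (hc : c = (2 * (d : ℝ) - 1) * t + t⁻¹)
    (x₀ : ∀ N : ℕ, Fin d → ZMod N) :
    (∀ N : ℕ, 1 ≤ N → Summable (AltZeta.zetaTerm (AltZeta.torus d N) (x₀ N) t)) ∧
    IntegrableOn (AltZeta.logAbs
      ((∑ j : Fin d, (AltZeta.X j + AltZeta.Xinv j)) - algebraMap ℂ (AltZeta.Laurent d) (c : ℂ)))
      (AltZeta.cube d) ∧
    IntegrableOn (AltZeta.logAbs
      (-(∑ j : Fin d, (AltZeta.X j + AltZeta.Xinv j)) - algebraMap ℂ (AltZeta.Laurent d) (c : ℂ)))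
      (AltZeta.cube d) ∧
    ∃ ℓ : ℝ, 0 < ℓ ∧
      Tendsto (fun N : ℕ => (AltZeta.altZeta (AltZeta.torus d N) (x₀ N) t)⁻¹) atTop (𝓝 ℓ) ∧
      Real.log ℓ =
        2 * ((d : ℝ) - 1) * Real.log (1 - t ^ 2) + 2 * Real.log (-t)
        + AltZeta.mahler
            ((∑ j : Fin d, (AltZeta.X j + AltZeta.Xinv j))
              - algebraMap ℂ (AltZeta.Laurent d) (c : ℂ))
        + AltZeta.mahler
            (-(∑ j : Fin d, (AltZeta.X j + AltZeta.Xinv j))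
              - algebraMap ℂ (AltZeta.Laurent d) (c : ℂ)) := by
  have hd' : (1 : ℝ) ≤ d := by exact_mod_cast hd
  have hq : (1 : ℝ) ≤ 2 * d - 1 := by linarith
  have htq : -1 < t * (2 * d - 1) := (div_lt_iff₀ (by linarith)).1 ht
  have htq' : |t| * (2 * d - 1) < 1 := by
    rw [abs_of_neg ht0]
    linarith
  -- As `cosSum` takes values in `[-2d, 2d]`, this keeps `± cosSum - c` in a compact interval of
  -- positive numbers, on which the logarithm is bounded.
  have hcd : c < -(2 * d) := by
    have := add_lt_neg_two_mul hq htq ht0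
    rw [← hc] at this
    linarith
  have ht1 : 0 < 1 - t ^ 2 := by nlinarith
  have hpos : ∀ s : Fin d → ℝ, cosSum s - c ∈ Set.Icc (-(2 * d) - c) (2 * d - c) := fun s => by
    have := abs_le.1 (abs_cosSum_le s)
    constructor <;> linarith [this.1, this.2]
  have hpos' : ∀ s : Fin d → ℝ, -cosSum s - c ∈ Set.Icc (-(2 * d) - c) (2 * d - c) := fun s => by
    have := abs_le.1 (abs_cosSum_le s)
    constructor <;> linarith [this.1, this.2]
  have h0 : 0 < -(2 * d) - c := by linarith
  have hint : IntegrableOn (fun s : Fin d → ℝ => Real.log |cosSum s - c|) (cube d) :=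
    integrableOn_log_abs (continuous_cosSum.sub continuous_const) h0 hpos
  have hint' : IntegrableOn (fun s : Fin d → ℝ => Real.log |-cosSum s - c|) (cube d) :=
    integrableOn_log_abs (continuous_cosSum.neg.sub continuous_const) h0 hpos'
  have habs : ∀ s : Fin d → ℝ, |cosSum s - -c| = |-cosSum s - c| := fun s => by
    rw [← abs_neg]
    congr 1
    ring
  have hI := integral_log_norm_det hd ht0.ne ht1 hc
    (fun s => (h0.trans_le (hpos s).1).ne') hint
  -- The parameter is odd in `u`, so `-t` belongs to `-c`, and `|cosSum + c| = |-cosSum - c|` gives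
  -- the second Mahler measure.
  have hI' := integral_log_norm_det (u := -t) (c := -c) hd (neg_ne_zero.2 ht0.ne)
    (by rwa [neg_sq]) (by rw [hc, inv_neg]; ring)
    (fun s hs => (h0.trans_le (hpos' s).1).ne' (by linarith)) (by simpa only [habs] using hint')
  simp_rw [habs] at hI'
  rw [neg_sq] at hI'
  have hlim := tendsto_tsum_zetaTerm_torus hd htq' x₀
  rw [hI, hI'] at hlim
  refine ⟨fun N _ => Summable.of_norm_bounded (summable_zetaTerm_bound hd htq')
    fun n => norm_zetaTerm_torus_le hd N (x₀ N) t n, ?_, ?_, _, Real.exp_pos _,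
    (((Real.continuous_exp.tendsto _).comp hlim.neg).congr fun N => ?_), ?_⟩
  · exact hint.congr_fun_ae (Eventually.of_forall fun s => (logAbs_sum_sub c s).symm)
  · exact hint'.congr_fun_ae (Eventually.of_forall fun s => (logAbs_neg_sum_sub c s).symm)
  · rw [altZeta, ← Real.exp_neg]
    rfl
  · rw [Real.log_exp, AltZeta.mahler, AltZeta.mahler]
    simp_rw [logAbs_sum_sub, logAbs_neg_sum_sub]
    rw [← Real.log_neg_eq_log t]
    ring
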